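/- Let $K$ be a field and $A$ a finite-dimensional $K$-algebra; modules are right $A$-modules. Call $A$ \emph{Auslander--Gorenstein} if the regular module $A_A$ has finite injective dimension and, for a minimal injective coresolution $0\to A_A\to I^0\to I^1\to\cdots$, one has $\operatorname{pdim} I^i\le i$ for all $i\ge 0$. For a finitely generated module $M$, let $\Omega^t(M)$ be its $t$-th syzygy in a minimal projective resolution. A module $N$ is an \emph{$n$-th syzygy module} if there is an exact sequence $0\to N\to P_{n-1}\to\cdots\to P_0$ with all $P_i$ finitely generated projective. Define the \emph{delooping level} and the \emph{grade} of $M$ by $$\operatorname{del}(M)=\inf\{t\ge 0\mid \Omega^t(M)\text{ is a }(t+1)\text{-th syzygy module}\},\qquad \operatorname{grade}(M)=\inf\{i\ge 0\mid \operatorname{Ext}^i_A(M,A)\ne 0\}$$ (with $\inf\emptyset=\infty$). \textbf{Theorem.} Let $A$ be an Auslander--Gorenstein algebra and $S$ a simple $A$-module with injective envelope $I(S)$. Then $$\operatorname{del}(S)=\operatorname{grade}(S)=\operatorname{pdim} I(S).$$ -/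

import Mathlib

/-!
All notions are defined for left modules over an arbitrary ring `R`. Right modules over an algebra
`A` are modules over the opposite ring `Aᵐᵒᵖ`; in particular the right regular module `A_A` is `A`
with its `Aᵐᵒᵖ`-module structure by right multiplication.
-/

open CategoryTheory

universe u v

namespace HomAlg

section Modules

variable {R : Type u} [Ring R]

/-- `N` is an essential submodule of `M`: it meets every non-zero submodule non-trivially. -/
def IsEssential {M : Type v} [AddCommGroup M] [Module R M] (N : Submodule R M) : Prop :=
  ∀ X : Submodule R M, N ⊓ X = ⊥ → X = ⊥

/-- `N` is a superfluous (small) submodule of `M`. -/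
def IsSuperfluous {M : Type v} [AddCommGroup M] [Module R M] (N : Submodule R M) : Prop :=
  ∀ X : Submodule R M, N ⊔ X = ⊤ → X = ⊤

/-- `j : M → I` is an injective envelope of `M`. -/
structure IsInjectiveEnvelope {M I : ModuleCat.{v} R} (j : M →ₗ[R] I) : Prop where
  injective_module : Module.Injective R I
  injective : Function.Injective j
  essential : IsEssential (LinearMap.range j)

/-- `p : P → M` is a projective cover of `M`. -/
structure IsProjectiveCover {P M : ModuleCat.{v} R} (p : P →ₗ[R] M) : Prop where
  projective : Module.Projective R P
  surjective : Function.Surjective p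
  superfluous : IsSuperfluous (LinearMap.ker p)

/-- `IsSyzygyOf t M N` says that `N` is (isomorphic to) `Ω^t(M)`, the `t`-th syzygy of `M` in a
minimal projective resolution: `Ω^0(M) = M` and `Ω^{t+1}(M) = Ω^t(Ω(M))`, where `Ω(M)` is the
kernel of a projective cover of `M`. -/
def IsSyzygyOf : ℕ → ModuleCat.{v} R → ModuleCat.{v} R → Prop
  | 0, M, N => Nonempty (N ≃ₗ[R] M)
  | t + 1, M, N => ∃ (P : ModuleCat.{v} R) (p : P →ₗ[R] M),
      IsProjectiveCover p ∧ IsSyzygyOf t (ModuleCat.of R (LinearMap.ker p)) N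

/-- `N` is an `n`-th syzygy module: there is an exact sequence
`0 → N → P_{n-1} → ⋯ → P_0` with all `P_i` finitely generated projective. -/
def IsSyzygyModule : ℕ → ModuleCat.{v} R → Prop
  | 0, _ => True
  | n + 1, N => ∃ (P : ModuleCat.{v} R) (f : N →ₗ[R] P),
      Module.Finite R P ∧ Module.Projective R P ∧ Function.Injective f ∧
        IsSyzygyModule n (ModuleCat.of R (P ⧸ LinearMap.range f))

/-- The delooping level `del(M) = inf {t ≥ 0 | Ω^t(M) is a (t+1)-th syzygy module}`,
with `inf ∅ = ∞`. -/
noncomputable def deloopingLevel (M : ModuleCat.{v} R) : ℕ∞ :=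
  sInf {n : ℕ∞ | ∃ t : ℕ, n = t ∧ ∃ N : ModuleCat.{v} R, IsSyzygyOf t M N ∧ IsSyzygyModule (t + 1) N}

/-- A minimal injective coresolution `0 → M → I^0 → I^1 → ⋯`: an exact sequence with injective
`I^i` in which the image of each map is essential in its codomain. -/
structure MinimalInjectiveCoresolution (M : ModuleCat.{v} R) where
  I : ℕ → ModuleCat.{v} R
  ι : M →ₗ[R] I 0
  d : ∀ i, I i →ₗ[R] I (i + 1)
  injective_module : ∀ i, Module.Injective R (I i)
  ι_injective : Function.Injective ι
  exact_zero : Function.Exact ι (d 0)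
  exact_succ : ∀ i, Function.Exact (d i) (d (i + 1))
  ι_essential : IsEssential (LinearMap.range ι)
  d_essential : ∀ i, IsEssential (LinearMap.range (d i))

end Modules

section Algebras

variable (A : Type u) [Ring A]

/-- The right regular module `A_A`. -/
abbrev regularModule : ModuleCat.{u} Aᵐᵒᵖ := ModuleCat.of Aᵐᵒᵖ A

/-- `A` is Auslander–Gorenstein: `A_A` has finite injective dimension, and the terms of a minimal
injective coresolution of `A_A` satisfy `pdim I^i ≤ i` for all `i`. -/
def IsAuslanderGorenstein : Prop :=
  injectiveDimension (regularModule A) < ⊤ ∧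
    ∃ E : MinimalInjectiveCoresolution (regularModule A),
      ∀ i : ℕ, projectiveDimension (E.I i) ≤ i

/-- `grade(M) = inf {i ≥ 0 | Ext^i_A(M, A) ≠ 0}` for a right `A`-module `M`, with `inf ∅ = ∞`. -/
noncomputable def moduleGrade (M : ModuleCat.{u} Aᵐᵒᵖ) : ℕ∞ :=
  sInf {n : ℕ∞ | ∃ i : ℕ, n = i ∧ Nontrivial (Abelian.Ext M (regularModule A) i)}

end Algebras

end HomAlg

/-! Suppose Ω^t(M) is a (t+1)-th syzygy module and Ext^i(M, A) = 0 for all i ≤ t. Dimension shifting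
gives Ext^t(M, Ω^t(M)) = 0. For t ≥ 1 this splits the last projective cover, and the vanishing of
the Ext^i(M, A) carries projectivity back to M; then Hom(M, A) = 0 forces M = 0
(`subsingleton_of_isSyzygyOf`). Hence grade ≤ del for every nonzero finitely generated module.

Conversely, Ext^i(S, A) ≠ 0 yields a nonzero map S → I^i, injective because S is simple. Since pdim
I^i ≤ i, a horseshoe argument (`exists_isSyzygyOf_isSyzygyModule`) makes Ω^i(S) an (i+1)-th syzygy
module, so del(S) ≤ grade(S). The same map makes I(S) a summand of I^i, so pdim I(S) ≤ grade(S); the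
horseshoe argument for S ⊆ I(S) gives del(S) ≤ pdim I(S). -/

namespace HomAlg

/-! ### Projective covers over artinian rings -/

section ProjectiveCovers

variable {R : Type u} [Ring R]

theorem IsProjectiveCover.finite {P M : ModuleCat.{v} R} {p : P →ₗ[R] M}
    (hp : IsProjectiveCover p) [Module.Finite R M] : Module.Finite R P := by
  obtain ⟨s, hs⟩ := Module.Finite.fg_top (R := R) (M := M)
  choose g hg using hp.surjective
  have hspan : Submodule.map p (Submodule.span R (g '' s)) = ⊤ := by
    rw [Submodule.map_span, ← Set.image_comp, show (p ∘ g) = id from funext hg, Set.image_id, hs]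
  have htop : Submodule.span R (g '' s) = ⊤ := by
    apply hp.superfluous
    rw [eq_top_iff]
    intro x _
    obtain ⟨y, hy, hyx⟩ : p x ∈ Submodule.map p (Submodule.span R (g '' s)) := hspan ▸ trivial
    rw [← sub_add_cancel x y]
    exact add_mem (Submodule.mem_sup_left (by simp [hyx])) (Submodule.mem_sup_right hy)
  exact ⟨htop ▸ Submodule.fg_span (s.finite_toSet.image g)⟩

/-- Over an artinian ring, every finitely generated module has a projective cover. -/
theorem exists_isProjectiveCover [IsArtinianRing R] (M : ModuleCat.{u} R) [Module.Finite R M] :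
    ∃ (P : ModuleCat.{u} R) (p : P →ₗ[R] M), IsProjectiveCover p := by
  obtain ⟨n, π, hπ⟩ := Module.Finite.exists_fin' R M
  -- The cover is a minimal projective submodule of `R^n` still mapping onto `M`.
  let T : Set (Submodule R (Fin n → R)) := {X | Module.Projective R X ∧ X.map π = ⊤}
  have hT : T.Nonempty := by
    refine ⟨⊤, Module.Projective.of_equiv Submodule.topEquiv.symm, ?_⟩
    rw [Submodule.map_top, LinearMap.range_eq_top.2 hπ]
  obtain ⟨X, ⟨hXproj, hXtop⟩, hXmin⟩ :=
    (inferInstance : IsArtinian R (Fin n → R)).wf.has_min T hT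
  let p : X →ₗ[R] M := π ∘ₗ X.subtype
  have hp : Function.Surjective p := by
    rw [← LinearMap.range_eq_top, LinearMap.range_comp, Submodule.range_subtype, hXtop]
  refine ⟨ModuleCat.of R X, p, hXproj, hp, fun Y hY ↦ ?_⟩
  have hpY : Function.Surjective (p ∘ₗ Y.subtype) := by
    rw [← LinearMap.range_eq_top, LinearMap.range_comp, Submodule.range_subtype]
    have := congrArg (Submodule.map p) hY
    rw [Submodule.map_sup, Submodule.map_top, LinearMap.range_eq_top.2 hp] at this
    rwa [LinearMap.le_ker_iff_map.1 (le_refl (LinearMap.ker p)), bot_sup_eq] at this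
  obtain ⟨h, hh⟩ := Module.projective_lifting_property (p ∘ₗ Y.subtype) p hpY
  -- `f` has image in `Y` and satisfies `p ∘ f = p`. By Fitting, the image of a high power of `f` is
  -- a summand, hence projective, and still maps onto `M`; minimality makes it all of `X`, so `Y =
  -- ⊤`.
  let f : Module.End R X := Y.subtype ∘ₗ h
  have hpf (x : X) : p (f x) = p x := LinearMap.congr_fun hh x
  have hpfn (m : ℕ) (x : X) : p ((f ^ m) x) = p x := by
    induction m with
    | zero => simp
    | succ m ih => rw [pow_succ', Module.End.mul_apply, hpf, ih]
  obtain ⟨m, hm0, hm⟩ := ((Filter.eventually_gt_atTop 0).and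
    (LinearMap.eventually_isCompl_ker_pow_range_pow f)).exists
  have hprojrange : Module.Projective R (LinearMap.range (f ^ m)) :=
    Module.Projective.of_split (LinearMap.range (f ^ m)).subtype
      (Submodule.projectionOnto _ _ hm.symm) (by ext x; simp)
  have hmem : (LinearMap.range (f ^ m)).map X.subtype ∈ T := by
    refine ⟨Module.Projective.of_equiv
      (Submodule.equivMapOfInjective X.subtype X.injective_subtype _), ?_⟩
    rw [eq_top_iff]
    intro y _
    obtain ⟨x, rfl⟩ := hp y
    exact ⟨_, ⟨_, ⟨x, rfl⟩, rfl⟩, hpfn m x⟩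
  have hle : (LinearMap.range (f ^ m)).map X.subtype ≤ X := by
    rintro _ ⟨x, -, rfl⟩; exact x.2
  have heq : (LinearMap.range (f ^ m)).map X.subtype = X :=
    hle.eq_of_not_lt (hXmin _ hmem)
  rw [eq_top_iff]
  intro x _
  obtain ⟨_, ⟨z, rfl⟩, hzx⟩ := heq.ge x.2
  obtain ⟨k, rfl⟩ := Nat.exists_eq_succ_of_ne_zero hm0.ne'
  rw [← Subtype.ext hzx, pow_succ', Module.End.mul_apply]
  exact (h _).2

end ProjectiveCovers

/-! ### Syzygy modules and the horseshoe argument -/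

section Syzygies

variable {R : Type u} [Ring R]

theorem IsSyzygyModule.of_equiv {n : ℕ} {M N : ModuleCat.{v} R} (e : M ≃ₗ[R] N)
    (h : IsSyzygyModule n M) : IsSyzygyModule n N := by
  cases n with
  | zero => trivial
  | succ n =>
    obtain ⟨P, f, hfin, hproj, hf, h⟩ := h
    refine ⟨P, f ∘ₗ e.symm.toLinearMap, hfin, hproj, hf.comp e.symm.injective, ?_⟩
    rwa [LinearMap.range_comp_of_range_eq_top _ e.symm.range]

/-- The kernel of an epimorphism from a finitely generated projective module onto an `n`-th syzygy
module is an `(n+1)`-th syzygy module. -/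
theorem IsSyzygyModule.of_exact {n : ℕ} {K P C : ModuleCat.{v} R} [Module.Finite R P]
    [Module.Projective R P] {f : K →ₗ[R] P} {g : P →ₗ[R] C} (hf : Function.Injective f)
    (hfg : Function.Exact f g) (hg : Function.Surjective g) (h : IsSyzygyModule n C) :
    IsSyzygyModule (n + 1) K := by
  refine ⟨P, f, ‹_›, ‹_›, hf, h.of_equiv (M := C) ?_⟩
  exact (g.quotKerEquivOfSurjective hg).symm.trans
    (Submodule.quotEquivOfEq _ _ hfg.linearMap_ker_eq)

theorem shortExact_mk {X Y Z : ModuleCat.{v} R} {f : X →ₗ[R] Y} {g : Y →ₗ[R] Z}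
    (hf : Function.Injective f) (hfg : Function.Exact f g) (hg : Function.Surjective g) :
    (ModuleCat.shortComplexOfCompEqZero f g hfg.linearMap_comp_eq_zero).ShortExact :=
  ModuleCat.shortComplex_shortExact _ hfg hf hg

/-- A horseshoe argument: if `M` embeds into a module `J` of projective dimension at most `n` whose
cokernel is a `k`-th syzygy module, then `Ω^n(M)` is an `(n+k+1)`-th syzygy module. -/
theorem exists_isSyzygyOf_isSyzygyModule [IsArtinianRing R] (n : ℕ) :
    ∀ (k : ℕ) {M J C : ModuleCat.{u} R} [Module.Finite R J] (f : M →ₗ[R] J) (g : J →ₗ[R] C),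
      Function.Injective f → Function.Exact f g → Function.Surjective g →
      HasProjectiveDimensionLE J n → IsSyzygyModule k C →
      ∃ N : ModuleCat.{u} R, IsSyzygyOf n M N ∧ IsSyzygyModule (n + k + 1) N := by
  induction n with
  | zero =>
    intro k M J C _ f g hf hfg hg hJ hC
    have : Projective J := (projective_iff_hasProjectiveDimensionLE_zero J).2 hJ
    have : Module.Projective R J := (IsProjective.iff_projective J).2 this
    refine ⟨M, ⟨LinearEquiv.refl R M⟩, ?_⟩
    rw [zero_add]
    exact hC.of_exact hf hfg hg
  | succ n ih =>
    intro k M J C _ f g hf hfg hg hJ hC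
    have hMfin : Module.Finite R M := Module.Finite.of_injective f hf
    have hCfin : Module.Finite R C := Module.Finite.of_surjective g hg
    obtain ⟨P, p, hp⟩ := exists_isProjectiveCover M
    obtain ⟨Q, q, hq⟩ := exists_isProjectiveCover C
    have := hp.projective
    have := hq.projective
    have := hp.finite
    have := hq.finite
    obtain ⟨l, hl⟩ := Module.projective_lifting_property g q hg
    have hl (y : Q) : g (l y) = q y := LinearMap.congr_fun hl y
    have hgf (x : M) : g (f x) = 0 := (hfg _).2 ⟨x, rfl⟩
    -- Horseshoe: `ker h` is an extension of `ker q` by `ker p`, which replaces `J` one step down.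
    let h : (P × Q) →ₗ[R] J := (f ∘ₗ p).coprod l
    have hh : Function.Surjective h := by
      intro z
      obtain ⟨y, hy⟩ := hq.surjective (g z)
      obtain ⟨x, hx⟩ := (hfg (z - l y)).1 (by rw [map_sub, hl, hy, sub_self])
      obtain ⟨w, rfl⟩ := hp.surjective x
      exact ⟨(w, y), by simp [h, hx]⟩
    let ι : LinearMap.ker p →ₗ[R] LinearMap.ker h :=
      (LinearMap.inl R P Q ∘ₗ (LinearMap.ker p).subtype).codRestrict _ (fun x ↦ by simp [h])
    let π : LinearMap.ker h →ₗ[R] LinearMap.ker q :=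
      (LinearMap.snd R P Q ∘ₗ (LinearMap.ker h).subtype).codRestrict _ (fun x ↦ by
        have hx : f (p x.1.1) + l x.1.2 = 0 := x.2
        have := congrArg g hx
        rwa [map_add, hgf, zero_add, hl, map_zero] at this)
    have hι : Function.Injective ι := fun x y hxy ↦
      Subtype.ext (congrArg (fun z : LinearMap.ker h ↦ z.1.1) hxy)
    have hιπ : Function.Exact ι π := by
      rintro ⟨⟨x, y⟩, hxy⟩
      have hxy' : f (p x) + l y = 0 := hxy
      constructor
      · intro hy
        obtain rfl : y = 0 := congrArg Subtype.val hy
        have hx : p x = 0 := hf (by simpa using hxy')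
        exact ⟨⟨x, hx⟩, rfl⟩
      · rintro ⟨z, hz⟩
        exact Subtype.ext (congrArg (fun z : LinearMap.ker h ↦ z.1.2) hz).symm
    have hπ : Function.Surjective π := by
      rintro ⟨y, hy⟩
      obtain ⟨x, hx⟩ := (hfg (l y)).1 (by rw [hl]; exact hy)
      obtain ⟨w, hw⟩ := hp.surjective (-x)
      exact ⟨⟨(w, y), by simp [h, hw, hx]⟩, rfl⟩
    have hK : HasProjectiveDimensionLE (ModuleCat.of R (LinearMap.ker h)) n := by
      have hS := LinearMap.shortExact_shortComplexKer hh
      have : Projective (ModuleCat.of R (P × Q)) :=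
        (IsProjective.iff_projective (P × Q)).1 inferInstance
      exact (hS.hasProjectiveDimensionLT_X₃_iff n this).1 hJ
    have hKC : IsSyzygyModule (k + 1) (ModuleCat.of R (LinearMap.ker q)) :=
      hC.of_exact (f := (LinearMap.ker q).subtype) (g := q) (Submodule.injective_subtype _)
        (LinearMap.exact_subtype_ker_map q) hq.surjective
    have : IsNoetherian R (P × Q) := inferInstance
    have : Module.Finite R (ModuleCat.of R (LinearMap.ker h)) :=
      inferInstanceAs (Module.Finite R (LinearMap.ker h))
    -- Passing to kernels lowers `n` by one and raises `k` by one, so `n + k` is preserved.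
    obtain ⟨N, hN₁, hN₂⟩ := ih (k + 1) (M := ModuleCat.of R (LinearMap.ker p))
      (J := ModuleCat.of R (LinearMap.ker h)) (C := ModuleCat.of R (LinearMap.ker q))
      ι π hι hιπ hπ hK hKC
    refine ⟨N, ⟨P, p, hp, hN₁⟩, ?_⟩
    rwa [show n + 1 + k + 1 = n + (k + 1) + 1 by ring]

end Syzygies

/-! ### Vanishing of Ext against syzygy modules -/

section ExtVanishing

open Abelian

variable {R : Type u} [Ring R]

theorem subsingleton_ext_zero_iff {X Y : ModuleCat.{u} R} :
    Subsingleton (Ext X Y 0) ↔ Subsingleton (X →ₗ[R] Y) :=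
  Ext.homEquiv₀.subsingleton_congr.trans ModuleCat.homEquiv.subsingleton_congr

/-- If `Ext^i(M, -)` vanishes on the regular module, it vanishes on all finitely generated
projective modules. -/
theorem subsingleton_ext_of_projective {M G P : ModuleCat.{u} R} (e : R ≃ₗ[R] G) {i : ℕ}
    (h : Subsingleton (Ext M G i)) [Module.Finite R P] [Module.Projective R P] :
    Subsingleton (Ext M P i) := by
  obtain ⟨n, f, g, -, -, hfg⟩ := Module.Finite.exists_comp_eq_id_of_projective R P
  let a (k : Fin n) : P ⟶ G :=
    ModuleCat.ofHom (e.toLinearMap ∘ₗ LinearMap.proj k ∘ₗ g)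
  let b (k : Fin n) : G ⟶ P :=
    ModuleCat.ofHom (f ∘ₗ LinearMap.single R (fun _ ↦ R) k ∘ₗ e.symm.toLinearMap)
  -- The identity of `P` is a sum of maps through `G`, so each class in `Ext M P i` is a sum of
  -- classes factoring through `Ext M G i`.
  have hab : ∑ k, a k ≫ b k = 𝟙 P := by
    ext x
    have h1 (k : Fin n) : (ModuleCat.Hom.hom (a k ≫ b k)) x = f (Pi.single k (g x k)) := by
      simp [a, b]
    rw [ModuleCat.hom_sum, LinearMap.sum_apply]
    simp only [h1]
    rw [← map_sum, Finset.univ_sum_single]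
    exact LinearMap.congr_fun hfg x
  refine subsingleton_of_forall_eq 0 fun x ↦ ?_
  rw [← x.comp_mk₀_id, ← hab, Ext.mk₀_sum, Ext.comp_sum]
  refine Finset.sum_eq_zero fun k _ ↦ ?_
  rw [← Ext.mk₀_comp_mk₀, ← Ext.comp_assoc_of_second_deg_zero,
    Subsingleton.elim (x.comp (Ext.mk₀ (a k)) (add_zero i)) 0, Ext.zero_comp]

/-- Dimension shifting: for 0 → Y → P → C → 0, the group Ext^{j+1}(M, Y) sits between Ext^j(M, C)
and Ext^{j+1}(M, P). -/
theorem subsingleton_ext_of_isSyzygyModule {M G : ModuleCat.{u} R} (e : R ≃ₗ[R] G) (j : ℕ) :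
    ∀ {Y : ModuleCat.{u} R}, (∀ i ≤ j, Subsingleton (Ext M G i)) → IsSyzygyModule (j + 1) Y →
      Subsingleton (Ext M Y j) := by
  induction j with
  | zero =>
    rintro Y hM ⟨P, f, _, _, hf, -⟩
    have := subsingleton_ext_zero_iff.1 (subsingleton_ext_of_projective (P := P) e (hM 0 le_rfl))
    refine subsingleton_ext_zero_iff.2 ⟨fun x y ↦ LinearMap.ext fun z ↦ hf ?_⟩
    exact LinearMap.congr_fun (Subsingleton.elim (f ∘ₗ x) (f ∘ₗ y)) z
  | succ j ih =>
    rintro Y hM ⟨P, f, _, _, hf, hY⟩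
    have hP := subsingleton_ext_of_projective (P := P) e (hM (j + 1) le_rfl)
    have hC := ih (fun i hi ↦ hM i (by lia)) hY
    have hS := shortExact_mk (X := Y) (Y := P) (Z := ModuleCat.of R (P ⧸ LinearMap.range f)) hf
      (LinearMap.exact_map_mkQ_range f) (Submodule.mkQ_surjective _)
    refine subsingleton_of_forall_eq 0 fun x ↦ ?_
    obtain ⟨y, rfl⟩ := Ext.covariant_sequence_exact₁ M hS x (hP.elim _ _) rfl
    rw [hC.elim y 0, Ext.zero_comp]

theorem subsingleton_ext_ker {P M Y : ModuleCat.{u} R} {p : P →ₗ[R] M}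
    (hp : Function.Surjective p) [Module.Projective R P] {i : ℕ}
    (h : Subsingleton (Ext M Y (i + 2))) :
    Subsingleton (Ext (ModuleCat.of R (LinearMap.ker p)) Y (i + 1)) := by
  have hS := LinearMap.shortExact_shortComplexKer hp
  have : Projective (ModuleCat.of R P) := (IsProjective.iff_projective P).1 inferInstance
  refine subsingleton_of_forall_eq 0 fun x ↦ ?_
  obtain ⟨y, rfl⟩ := Ext.contravariant_sequence_exact₁ hS Y x (n₁ := i + 2) (by lia)
    (Subsingleton.elim (α := Ext M Y (i + 2)) _ _)
  have hy : y = 0 := Ext.eq_zero_of_projective (P := ModuleCat.of R P) y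
  rw [hy, Ext.comp_zero]

/-- The obstruction to lifting the identity of `M` along `p` lies in this Ext group, so `p` splits.
-/
theorem projective_of_subsingleton_ext_one {P M : ModuleCat.{u} R} {p : P →ₗ[R] M}
    (hp : Function.Surjective p) [Module.Projective R P]
    (h : Subsingleton (Ext M (ModuleCat.of R (LinearMap.ker p)) 1)) : Module.Projective R M := by
  have hS := LinearMap.shortExact_shortComplexKer hp
  obtain ⟨s, hs⟩ := Ext.covariant_sequence_exact₃ M hS (Ext.mk₀ (𝟙 M)) (zero_add 1) (h.elim _ _)
  obtain ⟨s, rfl⟩ := Ext.homEquiv₀.symm.surjective s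
  rw [Ext.homEquiv₀_symm_apply, Ext.mk₀_comp_mk₀] at hs
  have hs := (Ext.mk₀_bijective _ _).1 hs
  exact Module.Projective.of_split s.hom p (by
    ext x; exact LinearMap.congr_fun (congrArg ModuleCat.Hom.hom hs) x)

/-- By induction `ker p` is finitely generated projective, so Ext^1(M, G) = 0 gives Ext^1(M, ker p)
= 0 and `p` splits. -/
theorem projective_of_isSyzygyOf [IsNoetherianRing R] {G : ModuleCat.{u} R} (e : R ≃ₗ[R] G)
    (t : ℕ) : ∀ {M N : ModuleCat.{u} R} [Module.Finite R M], IsSyzygyOf (t + 1) M N →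
      (∀ i ≤ t, Subsingleton (Ext M G (i + 1))) → Subsingleton (Ext M N (t + 1)) →
      Module.Projective R M := by
  induction t with
  | zero =>
    rintro M N _ ⟨P, p, hp, ⟨φ⟩⟩ - hMN
    have := hp.projective
    refine projective_of_subsingleton_ext_one hp.surjective ?_
    refine subsingleton_of_forall_eq 0 fun x ↦ ?_
    rw [← x.comp_mk₀_id, ← φ.toModuleIso.inv_hom_id, ← Ext.mk₀_comp_mk₀,
      ← Ext.comp_assoc_of_second_deg_zero, hMN.elim (x.comp _ _) 0, Ext.zero_comp]
  | succ t ih =>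
    rintro M N _ ⟨P, p, hp, hN⟩ hM hMN
    have := hp.projective
    have := hp.finite
    have : Module.Finite R (ModuleCat.of R (LinearMap.ker p)) :=
      inferInstanceAs (Module.Finite R (LinearMap.ker p))
    have : Module.Projective R (ModuleCat.of R (LinearMap.ker p)) :=
      ih hN (fun i hi ↦ subsingleton_ext_ker hp.surjective (hM (i + 1) (by lia)))
        (subsingleton_ext_ker hp.surjective hMN)
    exact projective_of_subsingleton_ext_one hp.surjective
      (subsingleton_ext_of_projective e (hM 0 (by lia)))

/-- If `Ω^t(M)` is a `(t+1)`-th syzygy module and `Ext^i(M, R) = 0` for all `i ≤ t`, then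
`M = 0`. -/
theorem subsingleton_of_isSyzygyOf [IsNoetherianRing R] {G : ModuleCat.{u} R} (e : R ≃ₗ[R] G)
    {t : ℕ} {M N : ModuleCat.{u} R} [Module.Finite R M] (hMN : IsSyzygyOf t M N)
    (hN : IsSyzygyModule (t + 1) N) (hM : ∀ i ≤ t, Subsingleton (Ext M G i)) :
    Subsingleton M := by
  suffices h : Subsingleton (M →ₗ[R] M) from
    ⟨fun x y ↦ by
      rw [← LinearMap.id_apply (R := R) x, h.elim LinearMap.id 0, LinearMap.zero_apply,
        ← LinearMap.zero_apply (σ₁₂ := RingHom.id R) (M₂ := M) y, h.elim 0 LinearMap.id,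
        LinearMap.id_apply]⟩
  have hext := subsingleton_ext_of_isSyzygyModule e t hM hN
  cases t with
  | zero =>
    obtain ⟨φ⟩ := hMN
    rw [subsingleton_ext_zero_iff] at hext
    refine ⟨fun x y ↦ LinearMap.ext fun z ↦ φ.symm.injective ?_⟩
    exact LinearMap.congr_fun
      (hext.elim (φ.symm.toLinearMap ∘ₗ x) (φ.symm.toLinearMap ∘ₗ y)) z
  | succ t =>
    have := projective_of_isSyzygyOf e t hMN (fun i hi ↦ hM (i + 1) (by lia)) hext
    exact subsingleton_ext_zero_iff.1 (subsingleton_ext_of_projective e (hM 0 (by lia)))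

end ExtVanishing

/-! ### Injective coresolutions and envelopes -/

section InjectiveModules

open Abelian

variable {R : Type u} [Ring R]

theorem MinimalInjectiveCoresolution.nontrivial_hom {M : ModuleCat.{u} R}
    (E : MinimalInjectiveCoresolution M) {S : ModuleCat.{u} R} (i : ℕ) :
    Nontrivial (Ext S M i) → Nontrivial (S →ₗ[R] E.I i) := by
  -- Generalised from `M` to any cosyzygy `Z = ker (E.d k)`, so that induction on `i` can shift
  -- dimension along the coresolution.
  suffices h : ∀ {Z : ModuleCat.{u} R} (k m : ℕ) (f : Z →ₗ[R] E.I k), Function.Injective f →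
      Function.Exact f (E.d k) → m = k + i → Subsingleton (S →ₗ[R] E.I m) →
      Subsingleton (Ext S Z i) by
    contrapose!
    exact h 0 i E.ι E.ι_injective E.exact_zero (zero_add i).symm
  induction i with
  | zero =>
    rintro Z k _ f hf - rfl h
    refine subsingleton_ext_zero_iff.2 ⟨fun x y ↦ LinearMap.ext fun z ↦ hf ?_⟩
    exact LinearMap.congr_fun (h.elim (f ∘ₗ x) (f ∘ₗ y)) z
  | succ i ih =>
    rintro Z k m f hf hfd hm h
    have hZ : Subsingleton (Ext S (ModuleCat.of R (LinearMap.range (E.d k))) i) := by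
      refine ih (k + 1) m (LinearMap.range (E.d k)).subtype (Submodule.injective_subtype _)
        ?_ (by lia) h
      rw [LinearMap.exact_iff, Submodule.range_subtype, (E.exact_succ k).linearMap_ker_eq]
    have hS := shortExact_mk (X := Z) (Y := E.I k)
      (Z := ModuleCat.of R (LinearMap.range (E.d k))) (g := (E.d k).rangeRestrict) hf
      (by rw [LinearMap.exact_iff, LinearMap.ker_rangeRestrict, hfd.linearMap_ker_eq])
      (LinearMap.surjective_rangeRestrict _)
    have := E.injective_module k
    have : Injective (ModuleCat.of R (E.I k)) := Module.injective_object_of_injective_module R _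
    refine subsingleton_of_forall_eq 0 fun x ↦ ?_
    obtain ⟨y, rfl⟩ := Ext.covariant_sequence_exact₁ S hS x
      (Ext.eq_zero_of_injective (I := ModuleCat.of R (E.I k)) _) rfl
    have hy : y = 0 := hZ.elim _ _
    rw [hy, Ext.zero_comp]

/-- An injective envelope of a simple module `S` is a retract of every injective module to which
`S` maps non-trivially. -/
theorem IsInjectiveEnvelope.nonempty_retract {S I J : ModuleCat.{u} R} [IsSimpleModule R S]
    {j : S →ₗ[R] I} (hj : IsInjectiveEnvelope j) [Module.Injective R J]
    [Nontrivial (S →ₗ[R] J)] : Nonempty (Retract I J) := by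
  obtain ⟨φ, hφ⟩ := exists_ne (0 : S →ₗ[R] J)
  have hφ : Function.Injective φ := φ.injective_of_ne_zero hφ
  obtain ⟨h, hh⟩ := Module.Injective.out (R := R) (Q := J) j hj.injective φ
  have hinj : Function.Injective h := by
    rw [← LinearMap.ker_eq_bot]
    refine hj.essential _ (eq_bot_iff.2 ?_)
    rintro _ ⟨⟨x, rfl⟩, hx⟩
    have hx : φ x = 0 := (hh x).symm.trans hx
    rw [hφ (hx.trans φ.map_zero.symm), map_zero]
    exact zero_mem _
  have := hj.injective_module
  obtain ⟨r, hr⟩ := Module.Injective.out (R := R) (Q := I) h hinj LinearMap.id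
  exact ⟨⟨ModuleCat.ofHom h, ModuleCat.ofHom r, by ext x; exact hr x⟩⟩

/-- Over a finite-dimensional algebra, an essential extension of a finitely generated module is
finitely generated. -/
theorem IsEssential.finite (K : Type*) [Field K] [Algebra K R] [Module.Finite K R]
    {I : Type u} [AddCommGroup I] [Module R I] {N : Submodule R I} (hN : IsEssential N)
    [Module.Finite R N] : Module.Finite R I := by
  let : Module K I := Module.compHom I (algebraMap K R)
  have : IsScalarTower K R I := IsScalarTower.of_algebraMap_smul fun _ _ ↦ rfl
  have : SMulCommClass R K I := IsScalarTower.to_smulCommClass'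
  have : Module.Finite K N := Module.Finite.trans R N
  obtain ⟨ρ, hρ⟩ := (N.subtype.restrictScalars K).exists_leftInverse_of_injective
    (LinearMap.ker_eq_bot.2 N.injective_subtype)
  have hρ (y : N) : ρ y = y := LinearMap.congr_fun hρ y
  -- With `ρ` a `K`-linear retraction onto `N`, the kernel of `x ↦ (r ↦ ρ (r • x))` is an
  -- `R`-submodule meeting `N` trivially (take `r = 1`). Essentiality makes the map injective, and
  -- its target is finite-dimensional.
  let Φ : I →ₗ[K] R →ₗ[K] N :=
    { toFun x := ρ ∘ₗ (LinearMap.toSpanSingleton R I x).restrictScalars K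
      map_add' x y := by ext r; simp
      map_smul' c x := by ext r; simp [smul_comm r c x] }
  have hΦ (x : I) (r : R) : Φ x r = ρ (r • x) := rfl
  let X : Submodule R I :=
    { carrier := {x | Φ x = 0}
      add_mem' hx hy := by simp_all
      zero_mem' := by simp
      smul_mem' r x hx := by
        have hx : Φ x = 0 := hx
        refine LinearMap.ext fun s ↦ ?_
        rw [hΦ, smul_smul, ← hΦ, hx, LinearMap.zero_apply, LinearMap.zero_apply] }
  have hX : X = ⊥ := by
    refine hN X (eq_bot_iff.2 fun x ⟨hxN, hxX⟩ ↦ ?_)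
    have h1 : Φ x 1 = 0 := by rw [show Φ x = 0 from hxX, LinearMap.zero_apply]
    rw [hΦ, one_smul, hρ ⟨x, hxN⟩] at h1
    exact congrArg Subtype.val h1
  have hinj : Function.Injective Φ := by
    rw [← LinearMap.ker_eq_bot, eq_bot_iff]
    intro x hx
    exact hX.le (show x ∈ X from hx)
  have : Module.Finite K I := Module.Finite.of_injective Φ hinj
  exact Module.Finite.of_restrictScalars_finite K R I

theorem MinimalInjectiveCoresolution.finite (K : Type*) [Field K] [Algebra K R]
    [Module.Finite K R] {M : ModuleCat.{u} R} [Module.Finite R M]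
    (E : MinimalInjectiveCoresolution M) (i : ℕ) : Module.Finite R (E.I i) := by
  induction i with
  | zero => exact E.ι_essential.finite K
  | succ i _ => exact (E.d_essential i).finite K

end InjectiveModules

/-! ### Comparing delooping level and grade -/

section Main

open Abelian

theorem deloopingLevel_le {R : Type u} [Ring R] [IsArtinianRing R] {M J : ModuleCat.{u} R}
    [Module.Finite R J] {f : M →ₗ[R] J} (hf : Function.Injective f) {n : ℕ}
    (hJ : HasProjectiveDimensionLE J n) : deloopingLevel M ≤ n := by
  obtain ⟨N, hN₁, hN₂⟩ := exists_isSyzygyOf_isSyzygyModule n 0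
    (C := ModuleCat.of R (J ⧸ LinearMap.range f)) f (LinearMap.range f).mkQ hf
    (LinearMap.exact_map_mkQ_range f) (Submodule.mkQ_surjective _) hJ trivial
  exact sInf_le ⟨n, rfl, N, hN₁, hN₂⟩

variable (A : Type u) [Ring A]

/-- The right regular module of `A` is the left regular module of `Aᵐᵒᵖ`. -/
def regularModuleEquiv : Aᵐᵒᵖ ≃ₗ[Aᵐᵒᵖ] regularModule A :=
  { MulOpposite.opAddEquiv.symm with map_smul' := fun _ _ ↦ rfl }

theorem moduleGrade_le_deloopingLevel [IsNoetherianRing Aᵐᵒᵖ] (M : ModuleCat.{u} Aᵐᵒᵖ)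
    [Module.Finite Aᵐᵒᵖ M] [Nontrivial M] : moduleGrade A M ≤ deloopingLevel M := by
  refine le_sInf ?_
  rintro _ ⟨t, rfl, N, hMN, hN⟩
  by_contra! h
  refine not_subsingleton M
    (subsingleton_of_isSyzygyOf (regularModuleEquiv A) hMN hN fun i hi ↦ ?_)
  by_contra! hi'
  exact (h.trans_le (sInf_le ⟨i, rfl, hi'⟩)).not_ge (by exact_mod_cast hi)

theorem exists_nontrivial_ext_of_moduleGrade_ne_top {M : ModuleCat.{u} Aᵐᵒᵖ}
    (h : moduleGrade A M ≠ ⊤) :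
    ∃ i : ℕ, moduleGrade A M = i ∧ Nontrivial (Ext M (regularModule A) i) := by
  refine csInf_mem (s := {n : ℕ∞ | ∃ i : ℕ, n = i ∧ Nontrivial (Ext M (regularModule A) i)}) ?_
  by_contra! h'
  exact h ((congrArg sInf h').trans sInf_empty)

end Main

end HomAlg

theorem mainTheorem9 (K : Type v) [Field K] (A : Type u) [Ring A] [Algebra K A] [Module.Finite K A]
    (hA : HomAlg.IsAuslanderGorenstein A)
    (S : ModuleCat.{u} Aᵐᵒᵖ) (hS : IsSimpleModule Aᵐᵒᵖ S) :
    HomAlg.deloopingLevel S = HomAlg.moduleGrade A S ∧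
      ∀ (I : ModuleCat.{u} Aᵐᵒᵖ) (j : S →ₗ[Aᵐᵒᵖ] I), HomAlg.IsInjectiveEnvelope j →
        projectiveDimension I = (HomAlg.deloopingLevel S : WithBot ℕ∞) := by
  obtain ⟨-, E, hE⟩ := hA
  have : Module.Finite K Aᵐᵒᵖ := Module.Finite.equiv (MulOpposite.opLinearEquiv K)
  have : IsArtinianRing Aᵐᵒᵖ := IsArtinianRing.of_finite K Aᵐᵒᵖ
  have : Module.Finite Aᵐᵒᵖ (HomAlg.regularModule A) :=
    Module.Finite.equiv (HomAlg.regularModuleEquiv A)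
  have := IsSimpleModule.nontrivial Aᵐᵒᵖ S
  have hle : HomAlg.moduleGrade A S ≤ HomAlg.deloopingLevel S :=
    HomAlg.moduleGrade_le_deloopingLevel A S
  have hge : HomAlg.deloopingLevel S ≤ HomAlg.moduleGrade A S := by
    by_cases h : HomAlg.moduleGrade A S = ⊤
    · exact h ▸ le_top
    obtain ⟨i, hi, hext⟩ := HomAlg.exists_nontrivial_ext_of_moduleGrade_ne_top A h
    obtain ⟨φ, hφ⟩ := @exists_ne _ (E.nontrivial_hom i hext) 0
    have := E.finite K i
    rw [hi]
    exact HomAlg.deloopingLevel_le (φ.injective_of_ne_zero hφ)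
      ((projectiveDimension_le_iff _ _).1 (hE i))
  have heq := hge.antisymm hle
  refine ⟨heq, fun I j hj ↦ le_antisymm ?_ ?_⟩
  · rw [heq]
    by_cases h : HomAlg.moduleGrade A S = ⊤
    · exact h ▸ le_top
    obtain ⟨i, hi, hext⟩ := HomAlg.exists_nontrivial_ext_of_moduleGrade_ne_top A h
    have := E.nontrivial_hom i hext
    have := E.injective_module i
    obtain ⟨ρ⟩ := hj.nonempty_retract (J := E.I i)
    rw [hi]
    exact ρ.projectiveDimension_le.trans (hE i)
  -- The horseshoe argument needs `I` finitely generated so that its quotients have projective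
  -- covers.
  · have : Module.Finite Aᵐᵒᵖ I := hj.essential.finite K
    generalize hp : projectiveDimension I = p
    induction p with
    -- Projective dimension `⊥` means `I = 0`, impossible since `S` embeds in `I`.
    | bot =>
      have := ModuleCat.isZero_iff_subsingleton.1 ((projectiveDimension_eq_bot_iff I).1 hp)
      exact absurd hj.injective.subsingleton (not_subsingleton S)
    | coe p =>
      refine WithBot.coe_le_coe.2 ?_
      induction p with
      | top => exact le_top
      | coe n =>
        exact HomAlg.deloopingLevel_le hj.injective ((projectiveDimension_le_iff I n).1 hp.le)
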